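/- Let $F=\mathbb{Q}(i)$, let $\theta=2\cos(2\pi/15)$ and let $K=F(\theta)=\mathbb{Q}(i,2\cos(2\pi/15))$. Then: 1. $K/F$ is a Galois extension of degree $4$. 2. None of $i$, $-i$, $-1$ is of the form $N_{K/F}(x)$ with $x\in K$. 3. There is exactly one $F$-automorphism $\sigma$ of $K$ with $\sigma(\theta)=2\cos(4\pi/15)$ (that is, $\sigma:\zeta_{15}+\zeta_{15}^{-1}\mapsto\zeta_{15}^{2}+\zeta_{15}^{-2}$ where $\zeta_{15}=e^{2\pi i/15}$), and $\sigma$ generates $\mathrm{Gal}(K/F)$, which is therefore cyclic of order $4$. 4. The cyclic algebra $$\mathcal{A}=(K/F,\sigma,i)=1\cdot K\oplus e\cdot K\oplus e^2\cdot K\oplus e^3\cdot K,\qquad l\,e=e\,\sigma(l)\ (l\in K),\qquad e^4=i,$$ is a division algebra: it is a nonzero ring in which every nonzero element is invertible. -/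

import Mathlib

open scoped BigOperators

noncomputable section

/-- The cyclic algebra `(K/F, σ, γ) = 1·K ⊕ e·K ⊕ ⋯ ⊕ e^(n-1)·K`, where `n` is the order of `σ`
(so `n = [K : F]` when `K/F` is cyclic with Galois group generated by `σ`).
The element `x_0 + e x_1 + ⋯ + e^(n-1) x_(n-1)` is the coefficient function `k ↦ x_k`. -/
def CyclicAlgebra {F K : Type*} [Field F] [Field K] [Algebra F K] (σ : K ≃ₐ[F] K) (_γ : F) :
    Type _ :=
  Fin (orderOf σ) → K

namespace CyclicAlgebra

variable {F K : Type*} [Field F] [Field K] [Algebra F K] {σ : K ≃ₐ[F] K} {γ : F}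

instance : AddCommGroup (CyclicAlgebra σ γ) :=
  inferInstanceAs (AddCommGroup (Fin (orderOf σ) → K))

instance : Module F (CyclicAlgebra σ γ) :=
  inferInstanceAs (Module F (Fin (orderOf σ) → K))

/-- The coefficient `x_k` of `x = x_0 + e x_1 + ⋯ + e^(n-1) x_(n-1)`. -/
def coeff (x : CyclicAlgebra σ γ) (k : Fin (orderOf σ)) : K := x k

@[ext] theorem ext {x y : CyclicAlgebra σ γ} (h : ∀ k, x.coeff k = y.coeff k) : x = y :=
  funext h

@[simp] theorem coeff_add (x y : CyclicAlgebra σ γ) (k : Fin (orderOf σ)) :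
    (x + y).coeff k = x.coeff k + y.coeff k := rfl

@[simp] theorem coeff_zero (k : Fin (orderOf σ)) : (0 : CyclicAlgebra σ γ).coeff k = 0 := rfl

@[simp] theorem coeff_smul (c : F) (x : CyclicAlgebra σ γ) (k : Fin (orderOf σ)) :
    (c • x).coeff k = c • x.coeff k := rfl

/-- The element `e^a l`, for any `a : ℕ`: as `e^n = γ`, it is `e^(a % n) (γ^(a / n) l)`. -/
def monomial (σ : K ≃ₐ[F] K) (γ : F) (a : ℕ) (l : K) : CyclicAlgebra σ γ :=
  fun k => if a % orderOf σ = k then algebraMap F K γ ^ (a / orderOf σ) * l else 0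

/-- The product determined by `(e^i x) (e^j y) = e^(i+j) (σ^j(x) y)`, that is by `l e = e σ(l)`,
and `e^n = γ`. -/
instance : Mul (CyclicAlgebra σ γ) where
  mul x y := ∑ i : Fin (orderOf σ), ∑ j : Fin (orderOf σ),
      monomial σ γ (i + j : ℕ) ((σ ^ (j : ℕ)) (x.coeff i) * y.coeff j)

instance : One (CyclicAlgebra σ γ) where
  one := monomial σ γ 0 1

theorem mul_def (x y : CyclicAlgebra σ γ) :
    x * y = ∑ i : Fin (orderOf σ), ∑ j : Fin (orderOf σ),
      monomial σ γ (i + j : ℕ) ((σ ^ (j : ℕ)) (x.coeff i) * y.coeff j) := rfl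

theorem one_def : (1 : CyclicAlgebra σ γ) = monomial σ γ 0 1 := rfl

theorem coeff_monomial (a : ℕ) (l : K) (k : Fin (orderOf σ)) :
    (monomial σ γ a l).coeff k =
      if a % orderOf σ = k then algebraMap F K γ ^ (a / orderOf σ) * l else 0 := rfl

theorem monomial_add (a : ℕ) (l m : K) :
    monomial σ γ a (l + m) = monomial σ γ a l + monomial σ γ a m := by
  ext k
  simp only [coeff_add, coeff_monomial]
  split_ifs <;> ring

@[simp] theorem monomial_zero (a : ℕ) : monomial σ γ a 0 = 0 := by
  ext k; simp [coeff_monomial]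

theorem monomial_smul (c : F) (a : ℕ) (l : K) :
    monomial σ γ a (c • l) = c • monomial σ γ a l := by
  ext k
  simp only [coeff_smul, coeff_monomial, Algebra.smul_def]
  split_ifs <;> ring

theorem monomial_mod (a : ℕ) (l : K) :
    monomial σ γ (a % orderOf σ) (algebraMap F K γ ^ (a / orderOf σ) * l) = monomial σ γ a l := by
  ext k
  have hn : 0 < orderOf σ := lt_of_le_of_lt (Nat.zero_le _) k.isLt
  simp [coeff_monomial, Nat.div_eq_of_lt (Nat.mod_lt a hn)]

/-- Every element is `x_0 + e x_1 + ⋯ + e^(n-1) x_(n-1)`. -/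
theorem sum_monomial (x : CyclicAlgebra σ γ) :
    ∑ i : Fin (orderOf σ), monomial σ γ i (x.coeff i) = x := by
  ext k
  have h : (∑ i : Fin (orderOf σ), monomial σ γ i (x.coeff i)).coeff k =
      ∑ i : Fin (orderOf σ), (monomial σ γ i (x.coeff i)).coeff k :=
    Finset.sum_apply (M := fun _ => K) k _ _
  rw [h, Finset.sum_eq_single k]
  · simp [coeff_monomial, Nat.mod_eq_of_lt k.isLt, Nat.div_eq_of_lt k.isLt]
  · intro i _ hik
    rw [coeff_monomial, if_neg]
    rw [Nat.mod_eq_of_lt i.isLt]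
    exact fun h => hik (Fin.ext h)
  · simp

protected theorem left_distrib' (x y z : CyclicAlgebra σ γ) : x * (y + z) = x * y + x * z := by
  simp only [mul_def, coeff_add, mul_add, monomial_add, Finset.sum_add_distrib]

protected theorem right_distrib' (x y z : CyclicAlgebra σ γ) : (x + y) * z = x * z + y * z := by
  simp only [mul_def, coeff_add, map_add, add_mul, monomial_add, Finset.sum_add_distrib]

instance : NonUnitalNonAssocRing (CyclicAlgebra σ γ) where
  left_distrib := CyclicAlgebra.left_distrib'
  right_distrib := CyclicAlgebra.right_distrib'
  zero_mul x := by simp [mul_def]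
  mul_zero x := by simp [mul_def]

theorem monomial_mul_monomial (a b : ℕ) (x y : K) :
    monomial σ γ a x * monomial σ γ b y = monomial σ γ (a + b) ((σ ^ b) x * y) := by
  rcases Nat.eq_zero_or_pos (orderOf σ) with hn | hn
  · ext k
    exact absurd k.isLt (by omega)
  have hb : σ ^ (b % orderOf σ) = σ ^ b := pow_mod_orderOf σ b
  rw [mul_def, Finset.sum_eq_single (⟨a % orderOf σ, Nat.mod_lt a hn⟩ : Fin (orderOf σ)),
    Finset.sum_eq_single (⟨b % orderOf σ, Nat.mod_lt b hn⟩ : Fin (orderOf σ))]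
  · simp only [coeff_monomial, if_true, map_mul, map_pow, AlgEquiv.commutes, hb]
    rw [← monomial_mod (a + b), ← monomial_mod (a % orderOf σ + b % orderOf σ), ← Nat.add_mod]
    congr 1
    have h : (a + b) / orderOf σ =
        (a % orderOf σ + b % orderOf σ) / orderOf σ + a / orderOf σ + b / orderOf σ := by
      have h1 : a + b = (a % orderOf σ + b % orderOf σ) +
          orderOf σ * (a / orderOf σ + b / orderOf σ) := by
        have := Nat.mod_add_div a (orderOf σ)
        have := Nat.mod_add_div b (orderOf σ)
        rw [mul_add]; omega
      conv_lhs => rw [h1]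
      rw [Nat.add_mul_div_left _ _ hn, add_assoc]
    rw [h, pow_add, pow_add]
    ring
  · intro j _ hj
    rw [coeff_monomial b, if_neg (fun h => hj (Fin.ext h.symm)), mul_zero, monomial_zero]
  · simp
  · intro i _ hi
    refine Finset.sum_eq_zero fun j _ => ?_
    rw [coeff_monomial a, if_neg (fun h => hi (Fin.ext h.symm)), map_zero, zero_mul,
      monomial_zero]
  · simp

instance : Ring (CyclicAlgebra σ γ) where
  mul_assoc x y z := by
    rw [← sum_monomial x, ← sum_monomial y, ← sum_monomial z]
    simp only [Finset.sum_mul, Finset.mul_sum, monomial_mul_monomial, map_mul]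
    refine Finset.sum_congr rfl fun k _ => ?_
    refine Finset.sum_congr rfl fun j _ => Finset.sum_congr rfl fun i _ => ?_
    rw [add_assoc, add_comm (j : ℕ) k, pow_add, AlgEquiv.mul_apply, mul_assoc]
  one_mul x := by
    rw [← sum_monomial x]
    simp [one_def, Finset.mul_sum, monomial_mul_monomial]
  mul_one x := by
    rw [← sum_monomial x]
    simp [one_def, Finset.sum_mul, monomial_mul_monomial]

instance : Algebra F (CyclicAlgebra σ γ) :=
  Algebra.ofModule
    (fun c x y => by
      simp only [mul_def, coeff_smul, map_smul, smul_mul_assoc, monomial_smul, Finset.smul_sum])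
    (fun c x y => by
      simp only [mul_def, coeff_smul, mul_smul_comm, monomial_smul, Finset.smul_sum])

/-- The defining relation `l e = e σ(l)`. -/
theorem commutation (l : K) :
    monomial σ γ 0 l * monomial σ γ 1 1 = monomial σ γ 1 1 * monomial σ γ 0 (σ l) := by
  simp [monomial_mul_monomial]

/-- The defining relation `e^n = γ`. -/
theorem generator_pow :
    monomial σ γ 1 1 ^ orderOf σ = algebraMap F (CyclicAlgebra σ γ) γ := by
  have h : ∀ a : ℕ, monomial σ γ 1 1 ^ a = monomial σ γ a 1 := by
    intro a
    induction a with
    | zero => rw [pow_zero, one_def]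
    | succ a ih => rw [pow_succ, ih, monomial_mul_monomial]; simp
  rw [h, Algebra.algebraMap_eq_smul_one, one_def, ← monomial_smul]
  ext k
  have hn : 0 < orderOf σ := lt_of_le_of_lt (Nat.zero_le _) k.isLt
  simp [coeff_monomial, Nat.div_self hn, Algebra.smul_def]

end CyclicAlgebra

/-- The field `ℚ(i)` inside `ℂ`. -/
abbrev GaussianField : IntermediateField ℚ ℂ := IntermediateField.adjoin ℚ {Complex.I}

/-- The element `i` of `ℚ(i)`. -/
def gaussI : GaussianField := IntermediateField.AdjoinSimple.gen ℚ Complex.I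

/-- The field `K = ℚ(i, 2 cos(2π/15))` inside `ℂ`, as an extension of `ℚ(i)`. -/
abbrev FieldK : IntermediateField GaussianField ℂ :=
  IntermediateField.adjoin GaussianField {((2 * Real.cos (2 * Real.pi / 15) : ℝ) : ℂ)}

/-- The generator `θ = 2 cos(2π/15)` of `K` over `ℚ(i)`. -/
def theta : FieldK :=
  IntermediateField.AdjoinSimple.gen GaussianField ((2 * Real.cos (2 * Real.pi / 15) : ℝ) : ℂ)

/-- A ring is a division ring if it is nonzero and all its nonzero elements are invertible. -/
def IsDivisionAlgebra (A : Type*) [Ring A] : Prop :=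
  Nontrivial A ∧ ∀ x : A, x ≠ 0 → IsUnit x

end

/-!
Let `v` be a place of `K` above the prime `2 + i` of `ℤ[i]`, which lies over `5`. The element
`y = θ + 1` satisfies the Eisenstein equation `y⁴ = 5 (1 - y - y² + y³)`, and `5 = (2 + i) (2 - i)`
with `2 - i` a unit at `v`; so `v(y)⁴ = v(2 + i)`, while the values of `ℚ(i)` are the powers of
`v(2 + i)`. Hence the nonzero terms of a sum `a₀ + a₁ y + a₂ y² + a₃ y³` with `aᵢ ∈ ℚ(i)` have
distinct values, and one of them dominates (`Valuation.exists_map_sum_eq_max`). This is total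
ramification, and it has four consequences: `1, y, y², y³` are linearly independent, so that
`[K : ℚ(i)] = 4`; the residue field of `v` is `𝔽₅` (`exists_intCast_map_sub_lt_one`); `v` is
invariant under automorphisms (`map_algEquiv`); and automorphisms act trivially on the residue
field (`map_algEquiv_sub_lt_one`).

*Galois group.* With `f` the minimal polynomial of `θ`, `f(x² - 2) = f(x) f(-x)`, so
`θ ↦ θ² - 2 = 2 cos (4π/15)` defines an automorphism. It has order `4`, hence generates the group.

*Norms.* If `N(x)` is a unit at `v`, then so is `x`, its conjugates all have the same residue `m`,
and `N(x)` has residue `m⁴ = 1`. But `i`, `-i`, `-1` have residues `3`, `2`, `4`.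

*The algebra.* Modulo the maximal ideal of `v`, the elements `∑ eᵏ xₖ` with coefficients integral
at `v` form the ring `𝔽₅[e]/(e⁴ - 3)`, which is the field with `625` elements because `3` has order
`4` in `𝔽₅ˣ`. Two nonzero elements of the algebra can be scaled by elements of `K` so that their
coefficients are integral and not all in the maximal ideal; their product is then nonzero modulo
the maximal ideal (`CyclicAlgebra.noZeroDivisors_of_irreducible`). A finite-dimensional algebra
without zero divisors is a division algebra.
-/

/-! ### Cyclic algebras over a valued field -/

section

open Polynomial

namespace CyclicAlgebra

variable {F K : Type*} [Field F] [Field K] [Algebra F K] {σ : K ≃ₐ[F] K} {γ : F}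

/-- The coefficients of a product, `monomial` spelled out. -/
theorem coeff_mul (x y : CyclicAlgebra σ γ) (k : Fin (orderOf σ)) :
    (x * y).coeff k = ∑ i : Fin (orderOf σ), ∑ j : Fin (orderOf σ),
      if ((i : ℕ) + j) % orderOf σ = k then
        algebraMap F K γ ^ (((i : ℕ) + j) / orderOf σ) *
          ((σ ^ (j : ℕ)) (x.coeff i) * y.coeff j) else 0 := by
  have h : ∀ f : Fin (orderOf σ) → CyclicAlgebra σ γ,
      (∑ i, f i).coeff k = ∑ i, (f i).coeff k := fun f => Finset.sum_apply (M := fun _ => K) k _ _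
  simp only [mul_def, h, coeff_monomial]

theorem coeff_mul_monomial_zero (x : CyclicAlgebra σ γ) (l : K) (k : Fin (orderOf σ)) :
    (x * monomial σ γ 0 l).coeff k = x.coeff k * l := by
  have h : x * monomial σ γ 0 l = fun k => x.coeff k * l := by
    conv_lhs => rw [← sum_monomial x]
    rw [← sum_monomial (fun k => x.coeff k * l : CyclicAlgebra σ γ)]
    simp [Finset.sum_mul, monomial_mul_monomial, coeff]
  rw [h]; rfl

theorem coeff_monomial_zero_mul (x : CyclicAlgebra σ γ) (l : K) (k : Fin (orderOf σ)) :
    (monomial σ γ 0 l * x).coeff k = (σ ^ (k : ℕ)) l * x.coeff k := by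
  have h : monomial σ γ 0 l * x = fun k : Fin (orderOf σ) => (σ ^ (k : ℕ)) l * x.coeff k := by
    conv_lhs => rw [← sum_monomial x]
    rw [← sum_monomial (fun k : Fin (orderOf σ) => (σ ^ (k : ℕ)) l * x.coeff k :
      CyclicAlgebra σ γ)]
    simp [Finset.mul_sum, monomial_mul_monomial, coeff]
  rw [h]; rfl

theorem valuation_pow_apply {V : ValuationSubring K}
    (hσ : ∀ x, V.valuation (σ x) = V.valuation x) (j : ℕ) (x : K) :
    V.valuation ((σ ^ j) x) = V.valuation x := by
  induction j generalizing x with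
  | zero => simp
  | succ j ih => rw [pow_succ, AlgEquiv.mul_apply, ih, hσ]

theorem valuation_pow_apply_sub_lt_one {V : ValuationSubring K}
    (hσ : ∀ x, V.valuation (σ x) = V.valuation x)
    (hres : ∀ x ∈ V, V.valuation (σ x - x) < 1) (j : ℕ) (x : K) (hx : x ∈ V) :
    V.valuation ((σ ^ j) x - x) < 1 := by
  induction j with
  | zero => simp
  | succ j ih =>
    have h : (σ ^ (j + 1)) x - x = (σ ^ j) (σ x - x) + ((σ ^ j) x - x) := by
      rw [pow_succ, AlgEquiv.mul_apply, map_sub]; ring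
    rw [h]
    refine V.valuation.map_add_lt ?_ ih
    rw [valuation_pow_apply hσ]
    exact hres x hx

/-- Reduction modulo the maximal ideal sends `∑ eᵏ xₖ`, with `xₖ ∈ V`, to `∑ ρᵏ x̄ₖ` in the field
`κ[ρ]/(ρⁿ - γ̄)`, where `κ` is the residue field; it respects products, because `σ` is trivial on
`κ`. So if a product vanishes, then all coefficients of one of the factors reduce to zero. -/
theorem valuation_coeff_lt_one_of_mul_eq_zero {V : ValuationSubring K}
    (hσ : ∀ x, V.valuation (σ x) = V.valuation x)
    (hres : ∀ x ∈ V, V.valuation (σ x - x) < 1)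
    (c : V) (hc : (c : K) = algebraMap F K γ)
    (hirr : Irreducible (X ^ orderOf σ - C (IsLocalRing.residue V c)))
    {x y : CyclicAlgebra σ γ} (hx : ∀ k, x.coeff k ∈ V) (hy : ∀ k, y.coeff k ∈ V)
    (hxy : x * y = 0) :
    (∀ k, V.valuation (x.coeff k) < 1) ∨ ∀ k, V.valuation (y.coeff k) < 1 := by
  set n := orderOf σ with hn
  set q : (IsLocalRing.ResidueField V)[X] := X ^ n - C (IsLocalRing.residue V c) with hq
  have : Fact (Irreducible q) := ⟨hirr⟩
  have hn0 : n ≠ 0 := by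
    intro h
    rw [hq, h, pow_zero, ← C_1, ← C_sub] at hirr
    exact not_irreducible_C _ hirr
  set ρ := AdjoinRoot.root q
  set f : V →+* AdjoinRoot q := (AdjoinRoot.of q).comp (IsLocalRing.residue V) with hf
  have hρ : ρ ^ n = f c := by
    have := AdjoinRoot.eval₂_root q
    rw [hq, eval₂_sub, eval₂_X_pow, eval₂_C, sub_eq_zero] at this
    exact this
  have hresf : ∀ (j : ℕ) (a b : V), (b : K) = (σ ^ j) a → f b = f a := by
    intro j a b hab
    rw [hf, RingHom.comp_apply, RingHom.comp_apply]
    congr 1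
    rw [← sub_eq_zero, ← map_sub, IsLocalRing.residue_eq_zero_iff, V.valuation_lt_one_iff]
    have := valuation_pow_apply_sub_lt_one hσ hres j a a.2
    rwa [← hab] at this
  -- powers of `ρ` below `n` are linearly independent over the residue field
  have hind : ∀ a : Fin n → V, ∑ k : Fin n, ρ ^ (k : ℕ) * f (a k) = 0 →
      ∀ k, V.valuation (a k : K) < 1 := by
    intro a ha k
    have hdeg : q.natDegree = n := by rw [hq, natDegree_X_pow_sub_C]
    let p : (IsLocalRing.ResidueField V)[X] :=
      ∑ k : Fin n, C (IsLocalRing.residue V (a k)) * X ^ (k : ℕ)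
    have hp : AdjoinRoot.mk q p = 0 := by
      rw [← ha]
      simp only [p, map_sum, map_mul, map_pow, AdjoinRoot.mk_C, AdjoinRoot.mk_X]
      exact Finset.sum_congr rfl fun k _ => mul_comm _ _
    have hpd : p.degree < q.degree := by
      rw [degree_eq_natDegree hirr.ne_zero, hdeg]
      exact degree_sum_fin_lt _
    have hp0 : p = 0 := eq_zero_of_dvd_of_degree_lt (AdjoinRoot.mk_eq_zero.1 hp) hpd
    have hk : p.coeff k = IsLocalRing.residue V (a k) := by
      simp only [p, finsetSum_coeff, coeff_C_mul, coeff_X_pow]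
      rw [Finset.sum_eq_single k]
      · simp
      · intro b _ hb
        rw [if_neg (fun h => hb (Fin.ext h.symm)), mul_zero]
      · simp
    rw [hp0, Polynomial.coeff_zero] at hk
    exact (V.valuation_lt_one_iff _).1 (IsLocalRing.residue_eq_zero_iff _ |>.1 hk.symm)
  let a : Fin n → V := fun k => ⟨x.coeff k, hx k⟩
  let b : Fin n → V := fun k => ⟨y.coeff k, hy k⟩
  have hs : ∀ (j : ℕ) (u : V), (σ ^ j) u ∈ V := fun j u => by
    rw [← V.valuation_le_one_iff, valuation_pow_apply hσ]
    exact V.valuation_le_one u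
  let s : ℕ → V → V := fun j u => ⟨(σ ^ j) u, hs j u⟩
  have hmul : ∀ k : Fin n, (∑ i : Fin n, ∑ j : Fin n,
      if ((i : ℕ) + j) % n = k then c ^ (((i : ℕ) + j) / n) * (s j (a i) * b j) else 0) = 0 := by
    intro k
    apply Subtype.ext
    have := congrArg (fun z => coeff z k) hxy
    simp only [coeff_mul] at this
    rw [CyclicAlgebra.coeff_zero] at this
    rw [ZeroMemClass.coe_zero, ← this]
    simp only [AddSubmonoidClass.coe_finsetSum]
    refine Finset.sum_congr rfl fun i _ => Finset.sum_congr rfl fun j _ => ?_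
    split_ifs with h
    · simp [hc, a, b, s, n]
    · simp
  have hprod : (∑ i : Fin n, ρ ^ (i : ℕ) * f (a i)) * ∑ j : Fin n, ρ ^ (j : ℕ) * f (b j) = 0 := by
    have h1 : ∑ k : Fin n, ρ ^ (k : ℕ) * f (∑ i : Fin n, ∑ j : Fin n,
        if ((i : ℕ) + j) % n = k then c ^ (((i : ℕ) + j) / n) * (s j (a i) * b j) else 0) = 0 :=
      Finset.sum_eq_zero fun k _ => by rw [hmul k, map_zero, mul_zero]
    rw [← h1, Finset.sum_mul_sum]
    simp only [map_sum, Finset.mul_sum]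
    conv_rhs => rw [Finset.sum_comm]
    refine Finset.sum_congr rfl fun i _ => ?_
    conv_rhs => rw [Finset.sum_comm]
    refine Finset.sum_congr rfl fun j _ => ?_
    rw [Finset.sum_eq_single (⟨((i : ℕ) + j) % n, Nat.mod_lt _ (Nat.pos_of_ne_zero hn0)⟩ : Fin n)]
    · rw [if_pos rfl, map_mul, map_mul, map_pow, ← hρ, hresf j (a i) (s j (a i)) rfl, ← pow_mul,
        ← mul_assoc _ (_ ^ (_ * _)), ← pow_add, Nat.mod_add_div, pow_add]
      ring
    · intro k _ hk
      rw [if_neg (fun h => hk (Fin.ext h.symm)), map_zero, mul_zero]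
    · simp
  rcases mul_eq_zero.1 hprod with h | h
  · exact Or.inl (hind a h)
  · exact Or.inr (hind b h)

/-- A nonzero element has a coefficient of largest, nonzero value. -/
theorem exists_coeff_eq_max {V : ValuationSubring K} {x : CyclicAlgebra σ γ} (hx : x ≠ 0) :
    ∃ k, x.coeff k ≠ 0 ∧ ∀ j, V.valuation (x.coeff j) ≤ V.valuation (x.coeff k) := by
  have : ∃ k, x.coeff k ≠ 0 := by
    by_contra! h
    exact hx (ext h)
  obtain ⟨k₀, hk₀⟩ := this
  obtain ⟨k, -, hk⟩ := Finset.exists_max_image Finset.univ (fun k => V.valuation (x.coeff k))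
    ⟨k₀, Finset.mem_univ _⟩
  refine ⟨k, fun h => hk₀ ?_, fun j => hk j (Finset.mem_univ _)⟩
  have := hk k₀ (Finset.mem_univ _)
  rw [h, map_zero, le_zero_iff, map_eq_zero] at this
  exact this

/-- A cyclic algebra is a domain if `K` carries a `σ`-invariant valuation with trivial action of
`σ` on the residue field `κ`, and `Xⁿ - γ̄` is irreducible over `κ`: two factors of a vanishing
product can be multiplied by elements of `K` so that their coefficients have maximal
value `1`. -/
theorem noZeroDivisors_of_irreducible {V : ValuationSubring K}
    (hσ : ∀ x, V.valuation (σ x) = V.valuation x)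
    (hres : ∀ x ∈ V, V.valuation (σ x - x) < 1)
    (c : V) (hc : (c : K) = algebraMap F K γ)
    (hirr : Irreducible (X ^ orderOf σ - C (IsLocalRing.residue V c))) :
    NoZeroDivisors (CyclicAlgebra σ γ) := by
  refine ⟨fun {x y} hxy => ?_⟩
  by_contra! hne
  obtain ⟨k, hk0, hk⟩ := exists_coeff_eq_max (V := V) hne.1
  obtain ⟨m, hm0, hm⟩ := exists_coeff_eq_max (V := V) hne.2
  have hvk : V.valuation (x.coeff k) ≠ 0 := (_root_.map_ne_zero _).2 hk0
  have hvm : V.valuation (y.coeff m) ≠ 0 := (_root_.map_ne_zero _).2 hm0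
  set l := x.coeff k
  set r := y.coeff m
  set x' := x * monomial σ γ 0 l⁻¹ with hx'
  set y' := monomial σ γ 0 l * y * monomial σ γ 0 (l⁻¹ * r⁻¹) with hy'
  have hvx : ∀ j, V.valuation (x'.coeff j) = V.valuation (x.coeff j) / V.valuation l := by
    intro j
    rw [hx', coeff_mul_monomial_zero, map_mul, map_inv₀, div_eq_mul_inv]
  have hvy : ∀ j, V.valuation (y'.coeff j) = V.valuation (y.coeff j) / V.valuation r := by
    intro j
    rw [hy', coeff_mul_monomial_zero, coeff_monomial_zero_mul, map_mul, map_mul, map_mul,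
      valuation_pow_apply hσ, map_inv₀, map_inv₀]
    field_simp
  have h0 : x' * y' = 0 := by
    have h1 : monomial σ γ 0 l⁻¹ * monomial σ γ 0 l = 1 := by
      simp [monomial_mul_monomial, one_def, inv_mul_cancel₀ hk0]
    calc x' * y' = x * (monomial σ γ 0 l⁻¹ * monomial σ γ 0 l) * y
          * monomial σ γ 0 (l⁻¹ * r⁻¹) := by rw [hx', hy']; simp only [mul_assoc]
      _ = 0 := by rw [h1, mul_one, hxy, zero_mul]
  rcases valuation_coeff_lt_one_of_mul_eq_zero hσ hres c hc hirr (x := x') (y := y')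
    (fun j => by
      rw [← V.valuation_le_one_iff, hvx]
      exact div_le_one_of_le₀ (hk j) zero_le)
    (fun j => by
      rw [← V.valuation_le_one_iff, hvy]
      exact div_le_one_of_le₀ (hm j) zero_le) h0 with h | h
  · have := h k
    rw [hvx, div_self hvk] at this
    exact lt_irrefl _ this
  · have := h m
    rw [hvy, div_self hvm] at this
    exact lt_irrefl _ this

theorem isDivisionAlgebra_of_noZeroDivisors [FiniteDimensional F K] (hn : orderOf σ ≠ 0)
    (h : NoZeroDivisors (CyclicAlgebra σ γ)) : IsDivisionAlgebra (CyclicAlgebra σ γ) := by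
  have hnt : Nontrivial (CyclicAlgebra σ γ) := by
    refine ⟨1, 0, fun h => ?_⟩
    have := congrArg (fun z => coeff z ⟨0, Nat.pos_of_ne_zero hn⟩) h
    simp [one_def, coeff_monomial, coeff_zero] at this
  have : IsDomain (CyclicAlgebra σ γ) := NoZeroDivisors.to_isDomain _
  have : FiniteDimensional F (CyclicAlgebra σ γ) :=
    inferInstanceAs (FiniteDimensional F (Fin (orderOf σ) → K))
  refine ⟨hnt, fun x hx => ?_⟩
  let _ := divisionRingOfFiniteDimensional F (CyclicAlgebra σ γ)
  exact IsUnit.of_mul_eq_one x⁻¹ (mul_inv_cancel₀ hx)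

end CyclicAlgebra

end

/-! ### Totally ramified valuations -/

namespace Valuation

section TotallyRamified

variable {F K Γ₀ : Type*} [Field F] [Field K] [Algebra F K] [LinearOrderedCommGroupWithZero Γ₀]
  {v : Valuation K Γ₀} {y : K} {n : ℕ}

/-- If the values of `F` are `n`-th powers of `v y`, then the nonzero terms of `∑ aᵢ yⁱ`, `i < n`,
have distinct values, so that one term dominates. -/
theorem exists_map_sum_eq_max (hy0 : y ≠ 0) (hy1 : v y < 1)
    (hF : ∀ a : F, a ≠ 0 → ∃ k : ℤ, v (algebraMap F K a) = v y ^ ((n : ℤ) * k))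
    [NeZero n] (a : Fin n → F) :
    ∃ i, v (∑ j, algebraMap F K (a j) * y ^ (j : ℕ)) = v (algebraMap F K (a i) * y ^ (i : ℕ)) ∧
      ∀ j, v (algebraMap F K (a j) * y ^ (j : ℕ)) ≤ v (algebraMap F K (a i) * y ^ (i : ℕ)) := by
  have hvy : 0 < v y := zero_lt_iff.2 ((map_ne_zero v).2 hy0)
  obtain ⟨i, -, hi⟩ := Finset.exists_max_image Finset.univ
    (fun j : Fin n => v (algebraMap F K (a j) * y ^ (j : ℕ))) ⟨0, Finset.mem_univ _⟩
  refine ⟨i, ?_, fun j => hi j (Finset.mem_univ _)⟩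
  by_cases h0 : v (algebraMap F K (a i) * y ^ (i : ℕ)) = 0
  · rw [h0, Finset.sum_eq_zero, map_zero]
    intro j _
    have := hi j (Finset.mem_univ _)
    rw [h0, le_zero_iff] at this
    exact (map_eq_zero v).1 this
  refine map_sum_eq_of_lt v (Finset.mem_univ i) fun j hj => lt_of_le_of_ne (hi j (Finset.mem_univ _))
    fun heq => ?_
  have hji : j ≠ i := by simpa using hj
  have hval : ∀ j : Fin n, v (algebraMap F K (a j) * y ^ (j : ℕ)) ≠ 0 →
      ∃ k : ℤ, v (algebraMap F K (a j) * y ^ (j : ℕ)) = v y ^ ((n : ℤ) * k + (j : ℕ)) := by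
    intro j hj
    have ha : a j ≠ 0 := by
      intro h
      simp [h] at hj
    obtain ⟨k, hk⟩ := hF _ ha
    exact ⟨k, by rw [map_mul, map_pow, hk, zpow_add₀ hvy.ne', zpow_natCast]⟩
  obtain ⟨k, hk⟩ := hval i h0
  obtain ⟨l, hl⟩ := hval j (heq ▸ h0)
  rw [hk, hl] at heq
  have hexp := zpow_right_injective₀ hvy hy1.ne heq
  have hmod := congrArg (· % (n : ℤ)) hexp
  simp only [Int.mul_add_emod_self_left] at hmod
  rw [Int.emod_eq_of_lt (by positivity) (by exact_mod_cast j.isLt),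
    Int.emod_eq_of_lt (by positivity) (by exact_mod_cast i.isLt)] at hmod
  exact hji (Fin.ext (by exact_mod_cast hmod))

/-- The powers `1, y, …, y ^ (n - 1)` are linearly independent over `F`. -/
theorem eq_zero_of_sum_eq_zero (hy0 : y ≠ 0) (hy1 : v y < 1)
    (hF : ∀ a : F, a ≠ 0 → ∃ k : ℤ, v (algebraMap F K a) = v y ^ ((n : ℤ) * k))
    [NeZero n] (a : Fin n → F) (h : ∑ j, algebraMap F K (a j) * y ^ (j : ℕ) = 0) (j : Fin n) :
    a j = 0 := by
  obtain ⟨i, hi, hmax⟩ := exists_map_sum_eq_max hy0 hy1 hF a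
  have := hmax j
  rw [← hi, h, map_zero, le_zero_iff, map_eq_zero] at this
  simpa [hy0] using this

/-- Every element of the valuation ring in the span of the powers of `y` is congruent to an element
of `F`: the residue field does not grow. -/
theorem map_sub_lt_one_of_sum_le_one (hy0 : y ≠ 0) (hy1 : v y < 1)
    (hF : ∀ a : F, a ≠ 0 → ∃ k : ℤ, v (algebraMap F K a) = v y ^ ((n : ℤ) * k))
    [NeZero n] (a : Fin n → F) (h : v (∑ j, algebraMap F K (a j) * y ^ (j : ℕ)) ≤ 1) :
    v ((∑ j, algebraMap F K (a j) * y ^ (j : ℕ)) - algebraMap F K (a 0)) < 1 := by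
  have hvy : 0 < v y := zero_lt_iff.2 ((map_ne_zero v).2 hy0)
  obtain ⟨i, hi, hmax⟩ := exists_map_sum_eq_max hy0 hy1 hF a
  rw [hi] at h
  have hsum : (∑ j, algebraMap F K (a j) * y ^ (j : ℕ)) - algebraMap F K (a 0) =
      ∑ j ∈ Finset.univ.erase (0 : Fin n), algebraMap F K (a j) * y ^ (j : ℕ) := by
    rw [← Finset.add_sum_erase _ _ (Finset.mem_univ (0 : Fin n))]
    simp
  rw [hsum]
  refine v.map_sum_lt one_ne_zero fun j hj => lt_of_le_of_ne ((hmax j).trans h) fun h1 => ?_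
  have ha : a j ≠ 0 := by
    intro h
    simp [h] at h1
  obtain ⟨k, hk⟩ := hF _ ha
  -- a term of value `1` would have an exponent divisible by `n`
  rw [map_mul, map_pow, hk, ← zpow_natCast, ← zpow_add₀ hvy.ne', ← zpow_zero (v y)] at h1
  have hexp := zpow_right_injective₀ hvy hy1.ne h1
  have hdvd : (n : ℤ) ∣ (j : ℕ) := ⟨-k, by linarith⟩
  have hj0 := Nat.eq_zero_of_dvd_of_lt (Int.natCast_dvd_natCast.1 hdvd) j.isLt
  exact (Finset.mem_erase.1 hj).1 (Fin.ext (by simpa using hj0))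

/-- Two valuations that agree on `F` and at `y` agree on the span of the powers of `y`. -/
theorem map_sum_eq_map_sum {w : Valuation K Γ₀} (hy0 : y ≠ 0) (hy1 : v y < 1)
    (hF : ∀ a : F, a ≠ 0 → ∃ k : ℤ, v (algebraMap F K a) = v y ^ ((n : ℤ) * k))
    (hwy : w y = v y) (hwF : ∀ a : F, w (algebraMap F K a) = v (algebraMap F K a))
    [NeZero n] (a : Fin n → F) :
    w (∑ j, algebraMap F K (a j) * y ^ (j : ℕ)) = v (∑ j, algebraMap F K (a j) * y ^ (j : ℕ)) := by
  have hterm : ∀ j : Fin n, w (algebraMap F K (a j) * y ^ (j : ℕ)) =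
      v (algebraMap F K (a j) * y ^ (j : ℕ)) := by
    intro j
    rw [map_mul, map_mul, map_pow, map_pow, hwy, hwF]
  obtain ⟨i, hi, hmax⟩ := exists_map_sum_eq_max hy0 hy1 hF a
  obtain ⟨i', hi', hmax'⟩ := exists_map_sum_eq_max (v := w) hy0 (hwy.trans_lt hy1)
    (fun a ha => by rw [hwF, hwy]; exact hF a ha) a
  rw [hi, hi', hterm]
  exact le_antisymm (hmax _) (by rw [← hterm, ← hterm]; exact hmax' _)

end TotallyRamified

/-! ### The place `2 + i` of the Gaussian integers -/

section Gaussian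

variable {L Γ₀ : Type*} [Field L] [LinearOrderedCommGroupWithZero Γ₀]
  {v : Valuation L Γ₀} {φ : GaussianInt →+* L}

theorem two_add_i_mul_two_sub_i : (⟨2, 1⟩ : GaussianInt) * ⟨2, -1⟩ = 5 := by
  ext <;> rfl

theorem map_five_lt_one (hle : ∀ g, v (φ g) ≤ 1) (hlt : v (φ ⟨2, 1⟩) < 1) : v 5 < 1 := by
  have h : (5 : L) = φ ⟨2, 1⟩ * φ ⟨2, -1⟩ := by
    rw [← map_mul, two_add_i_mul_two_sub_i, map_ofNat]
  rw [h, map_mul]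
  exact mul_lt_one_of_lt_of_le hlt (hle _)

theorem map_intCast_eq_one (hle : ∀ g, v (φ g) ≤ 1) (hlt : v (φ ⟨2, 1⟩) < 1) {m : ℤ}
    (hm : ¬ (5 : ℤ) ∣ m) : v (m : L) = 1 := by
  have hint : ∀ k : ℤ, v (k : L) ≤ 1 := fun k => by simpa using hle (k : GaussianInt)
  have hcop : IsCoprime (5 : ℤ) m := (Prime.coprime_iff_not_dvd (Nat.prime_iff_prime_int.1 Nat.prime_five)).2 hm
  obtain ⟨a, b, hab⟩ := hcop
  refine le_antisymm (hint m) (not_lt.1 fun h => ?_)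
  have h1 : (a : L) * 5 + b * m = 1 := by exact_mod_cast congrArg (Int.cast : ℤ → L) hab
  have h2 : v ((a : L) * 5 + b * m) < 1 := by
    refine v.map_add_lt ?_ ?_
    · rw [map_mul]; exact mul_lt_one_of_nonneg_of_lt_one_right (hint a) zero_le (map_five_lt_one hle hlt)
    · rw [map_mul]; exact mul_lt_one_of_nonneg_of_lt_one_right (hint b) zero_le h
  rw [h1, map_one] at h2
  exact lt_irrefl _ h2

/-- Modulo `2 + i`, the Gaussian integer `a + b i` is the rational integer `a - 2 b`. -/
theorem two_add_i_dvd_iff (g : GaussianInt) :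
    (⟨2, 1⟩ : GaussianInt) ∣ g ↔ (5 : ℤ) ∣ g.re - 2 * g.im := by
  constructor
  · rintro ⟨h, rfl⟩
    exact ⟨-h.im, by simp; ring⟩
  · rintro ⟨k, hk⟩
    refine ⟨⟨2 * k + g.im, -k⟩, ?_⟩
    ext
    · simp
      linarith
    · simp

theorem map_eq_one_of_not_dvd (hle : ∀ g, v (φ g) ≤ 1) (hlt : v (φ ⟨2, 1⟩) < 1) {g : GaussianInt}
    (hg : ¬ (⟨2, 1⟩ : GaussianInt) ∣ g) : v (φ g) = 1 := by
  have h1 := map_intCast_eq_one hle hlt (fun h => hg ((two_add_i_dvd_iff g).2 h))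
  have h2 : g = ((g.re - 2 * g.im : ℤ) : GaussianInt) + (g.im : GaussianInt) * ⟨2, 1⟩ := by
    ext
    · simp
      ring
    · simp
  rw [h2, map_add, map_mul, map_intCast, map_add_eq_of_lt_left, h1]
  rw [h1, map_mul]
  exact mul_lt_one_of_nonneg_of_lt_one_right (hle _) zero_le hlt

theorem map_two_add_i_ne_zero [CharZero L] (φ : GaussianInt →+* L) : φ ⟨2, 1⟩ ≠ 0 := by
  intro h
  have := congrArg φ two_add_i_mul_two_sub_i
  rw [map_mul, h, zero_mul, map_ofNat] at this
  norm_num at this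

/-- Splitting off the powers of the prime `2 + i` from a fraction of Gaussian integers. -/
theorem exists_eq_zpow_mul_div [CharZero L] (φ : GaussianInt →+* L) {g h : GaussianInt} (hg : g ≠ 0)
    (hh : h ≠ 0) : ∃ (k : ℤ) (g' h' : GaussianInt), ¬ (⟨2, 1⟩ : GaussianInt) ∣ g' ∧
      ¬ (⟨2, 1⟩ : GaussianInt) ∣ h' ∧ φ g / φ h = φ ⟨2, 1⟩ ^ k * (φ g' / φ h') := by
  have hu : ¬ IsUnit (⟨2, 1⟩ : GaussianInt) := by
    rintro ⟨u, hu⟩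
    have h1 := two_add_i_dvd_iff 1
    rw [← hu] at h1
    have := h1.1 (Units.isUnit u).dvd
    simp at this
  obtain ⟨k, g', hg', rfl⟩ := WfDvdMonoid.max_power_factor' hg hu
  obtain ⟨l, h', hh', rfl⟩ := WfDvdMonoid.max_power_factor' hh hu
  refine ⟨k - l, g', h', hg', hh', ?_⟩
  rw [zpow_sub₀ (map_two_add_i_ne_zero φ), zpow_natCast, zpow_natCast, map_mul, map_mul, map_pow,
    map_pow, mul_div_mul_comm]

theorem exists_map_div_eq_zpow [CharZero L] (hle : ∀ g, v (φ g) ≤ 1) (hlt : v (φ ⟨2, 1⟩) < 1)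
    {g h : GaussianInt} (hg : g ≠ 0) (hh : h ≠ 0) :
    ∃ k : ℤ, v (φ g / φ h) = v (φ ⟨2, 1⟩) ^ k := by
  obtain ⟨k, g', h', hg', hh', heq⟩ := exists_eq_zpow_mul_div φ hg hh
  refine ⟨k, ?_⟩
  rw [heq, map_mul, map_div₀, map_zpow₀, map_eq_one_of_not_dvd hle hlt hg',
    map_eq_one_of_not_dvd hle hlt hh', div_one, mul_one]

/-- The residue field of `ℚ(i)` at `2 + i` is the prime field. -/
theorem exists_intCast_map_div_sub_lt_one [CharZero L] (hle : ∀ g, v (φ g) ≤ 1) (hlt : v (φ ⟨2, 1⟩) < 1)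
    {g h : GaussianInt} (h1 : v (φ g / φ h) ≤ 1) :
    ∃ m : ℤ, v (φ g / φ h - m) < 1 := by
  by_cases hg : g = 0
  · exact ⟨0, by simp [hg]⟩
  by_cases hh : h = 0
  · exact ⟨0, by simp [hh]⟩
  obtain ⟨k, g', h', hg', hh', heq⟩ := exists_eq_zpow_mul_div φ hg hh
  have hvg := map_eq_one_of_not_dvd hle hlt hg'
  have hvh := map_eq_one_of_not_dvd hle hlt hh'
  have hp : 0 < v (φ ⟨2, 1⟩) := zero_lt_iff.2 ((map_ne_zero v).2 (map_two_add_i_ne_zero φ))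
  have hv : v (φ g / φ h) = v (φ ⟨2, 1⟩) ^ k := by
    rw [heq, map_mul, map_div₀, map_zpow₀, hvg, hvh, div_one, mul_one]
  by_cases hk : k = 0
  · rw [heq, hk, zpow_zero, one_mul]
    rw [two_add_i_dvd_iff] at hg' hh'
    have hcop : IsCoprime (5 : ℤ) (h'.re - 2 * h'.im) :=
      (Prime.coprime_iff_not_dvd (Nat.prime_iff_prime_int.1 Nat.prime_five)).2 hh'
    obtain ⟨a, b, hab⟩ := hcop
    set m := b * (g'.re - 2 * g'.im) with hm
    refine ⟨m, ?_⟩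
    have hh0 : φ h' ≠ 0 := (map_ne_zero v).1 (by rw [hvh]; exact one_ne_zero)
    have hd : (⟨2, 1⟩ : GaussianInt) ∣ g' - m * h' := by
      rw [two_add_i_dvd_iff]
      refine ⟨a * (g'.re - 2 * g'.im), ?_⟩
      simp [hm]
      linear_combination (-(g'.re - 2 * g'.im)) * hab
    obtain ⟨c, hc⟩ := hd
    have hc' := congrArg φ hc
    rw [_root_.map_sub, map_mul, map_mul, map_intCast] at hc'
    have : φ g' / φ h' - m = (φ ⟨2, 1⟩ * φ c) / φ h' := by
      rw [← hc']; field_simp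
    rw [this, map_div₀, hvh, div_one, map_mul]
    exact mul_lt_one_of_lt_of_le hlt (hle _)
  · refine ⟨0, ?_⟩
    rw [Int.cast_zero, sub_zero]
    refine lt_of_le_of_ne h1 fun h => hk ?_
    rw [hv, ← zpow_zero (v (φ ⟨2, 1⟩))] at h
    exact zpow_right_injective₀ hp hlt.ne h

/-- `2 - i` is a unit at `2 + i`, so a root of `y⁴ = 5 (1 - y - y² + y³)`, which is an Eisenstein
equation, has a fourth of the value of `2 + i`. -/
theorem map_eisenstein_root (hle : ∀ g, v (φ g) ≤ 1) (hlt : v (φ ⟨2, 1⟩) < 1) {y : L}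
    (hy : y ^ 4 = 5 * (1 - y - y ^ 2 + y ^ 3)) : v y < 1 ∧ v y ^ 4 = v (φ ⟨2, 1⟩) := by
  have h5 := map_five_lt_one hle hlt
  have hy1 : v y < 1 := by
    by_contra! h
    have hle2 : v (1 - y - y ^ 2 + y ^ 3) ≤ v y ^ 3 := by
      refine v.map_add_le (v.map_sub_le (v.map_sub_le ?_ ?_) ?_) ?_
      · rw [map_one]; exact one_le_pow₀ h
      · exact le_self_pow₀ h (by norm_num)
      · rw [map_pow]; exact pow_le_pow_right₀ h (by norm_num)
      · rw [map_pow]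
    have h4 : v y ^ 4 < v y ^ 3 := by
      rw [← map_pow, hy, map_mul]
      calc v 5 * v (1 - y - y ^ 2 + y ^ 3) ≤ v 5 * v y ^ 3 := by gcongr
        _ < v y ^ 3 := mul_lt_of_lt_one_left (pow_pos (lt_of_lt_of_le one_pos h) _) h5
    exact absurd h4 (not_lt.2 (pow_le_pow_right₀ h (by norm_num)))
  refine ⟨hy1, ?_⟩
  have hu : v (1 - y - y ^ 2 + y ^ 3) = 1 := by
    have h : 1 - y - y ^ 2 + y ^ 3 = 1 - y * (1 + y - y ^ 2) := by ring
    rw [h]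
    refine v.map_one_sub_of_lt ?_
    rw [map_mul]
    refine mul_lt_one_of_lt_of_le hy1 (v.map_sub_le (v.map_add_le (map_one v).le hy1.le) ?_)
    rw [map_pow]
    exact pow_le_one₀ zero_le hy1.le
  have hq : v (φ ⟨2, -1⟩) = 1 :=
    map_eq_one_of_not_dvd hle hlt (by rw [two_add_i_dvd_iff]; norm_num)
  have h5' : (5 : L) = φ ⟨2, 1⟩ * φ ⟨2, -1⟩ := by
    rw [← map_mul, two_add_i_mul_two_sub_i, map_ofNat]
  rw [← map_pow, hy, map_mul, hu, mul_one, h5', map_mul, hq, mul_one]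

end Gaussian

end Valuation

section

open Polynomial

/-! ### The fields `ℚ(i)` and `K` -/

/-- `θ = 2 cos (2π/15)` is a root of the minimal polynomial of `ζ + ζ⁻¹`, `ζ = exp (2πi/15)`. -/
theorem two_cos_quartic :
    ((2 * Real.cos (2 * Real.pi / 15) : ℝ) : ℂ) ^ 4 - ((2 * Real.cos (2 * Real.pi / 15) : ℝ) : ℂ) ^ 3
      - 4 * ((2 * Real.cos (2 * Real.pi / 15) : ℝ) : ℂ) ^ 2
      + 4 * ((2 * Real.cos (2 * Real.pi / 15) : ℝ) : ℂ) + 1 = 0 := by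
  have hζ := Complex.isPrimitiveRoot_exp 15 (by norm_num)
  set z := Complex.exp (2 * Real.pi * Complex.I / (15 : ℕ)) with hz
  have h0 : z ≠ 0 := Complex.exp_ne_zero _
  have ht : ((2 * Real.cos (2 * Real.pi / 15) : ℝ) : ℂ) = z + z⁻¹ := by
    rw [hz, ← Complex.exp_neg]
    push_cast
    rw [Complex.cos]
    rw [mul_div_cancel₀ _ (two_ne_zero)]
    congr 2 <;> ring
  have h15 : z ^ 15 = 1 := hζ.pow_eq_one
  have h3 : z ^ 3 - 1 ≠ 0 := sub_ne_zero.2 (hζ.pow_ne_one_of_pos_of_lt (by norm_num) (by norm_num))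
  have h5 : z ^ 5 - 1 ≠ 0 := sub_ne_zero.2 (hζ.pow_ne_one_of_pos_of_lt (by norm_num) (by norm_num))
  have hcyc : z ^ 8 - z ^ 7 + z ^ 5 - z ^ 4 + z ^ 3 - z + 1 = 0 := by
    have h : (z ^ 3 - 1) * (z ^ 5 - 1) * (z ^ 8 - z ^ 7 + z ^ 5 - z ^ 4 + z ^ 3 - z + 1) = 0 := by
      linear_combination (z - 1) * h15
    simpa [h3, h5] using h
  rw [ht]
  have : (z + z⁻¹) ^ 4 - (z + z⁻¹) ^ 3 - 4 * (z + z⁻¹) ^ 2 + 4 * (z + z⁻¹) + 1 =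
      (z ^ 8 - z ^ 7 + z ^ 5 - z ^ 4 + z ^ 3 - z + 1) / z ^ 4 := by
    field_simp
    ring
  rw [this, hcyc, zero_div]

theorem coe_theta : ((theta : FieldK) : ℂ) = ((2 * Real.cos (2 * Real.pi / 15) : ℝ) : ℂ) := rfl

theorem theta_quartic : theta ^ 4 - theta ^ 3 - 4 * theta ^ 2 + 4 * theta + 1 = 0 := by
  apply Subtype.ext
  have := two_cos_quartic
  rw [← coe_theta] at this
  exact this

theorem two_cos_double (x : ℝ) : 2 * Real.cos (2 * x) = (2 * Real.cos x) ^ 2 - 2 := by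
  rw [Real.cos_two_mul]; ring

/-- `2 cos (4π/15) = θ² - 2`. -/
theorem coe_eq_two_cos_iff (x : FieldK) :
    (x : ℂ) = ((2 * Real.cos (4 * Real.pi / 15) : ℝ) : ℂ) ↔ x = theta ^ 2 - 2 := by
  have h : ((2 * Real.cos (4 * Real.pi / 15) : ℝ) : ℂ) = ((theta ^ 2 - 2 : FieldK) : ℂ) := by
    have h4 : 4 * Real.pi / 15 = 2 * (2 * Real.pi / 15) := by ring
    rw [h4, two_cos_double]
    push_cast
    rw [coe_theta]
    push_cast
    rfl
  rw [h]
  exact ⟨fun h => Subtype.ext h, fun h => congrArg _ h⟩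

theorem gaussI_mul_self : gaussI * gaussI = -1 := by
  apply Subtype.ext
  exact Complex.I_mul_I

/-- The embedding of the Gaussian integers into `ℚ(i)`. -/
noncomputable def gaussianIntHom : GaussianInt →+* GaussianField :=
  Zsqrtd.lift ⟨gaussI, by rw [gaussI_mul_self]; simp⟩

theorem gaussianIntHom_apply (g : GaussianInt) :
    gaussianIntHom g = (g.re : GaussianField) + (g.im : GaussianField) * gaussI := rfl

theorem coe_gaussianIntHom (g : GaussianInt) :
    ((gaussianIntHom g : GaussianField) : ℂ) = GaussianInt.toComplex g := by
  rw [gaussianIntHom_apply, GaussianInt.toComplex_def]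
  push_cast
  rfl

/-- `ℚ(i)` is the fraction field of the Gaussian integers. -/
theorem exists_gaussianIntHom_div (a : GaussianField) :
    ∃ g h, h ≠ 0 ∧ a = gaussianIntHom g / gaussianIntHom h := by
  obtain ⟨z, hz⟩ := a
  suffices H : ∃ g h : GaussianInt, h ≠ 0 ∧ z = GaussianInt.toComplex g / GaussianInt.toComplex h by
    obtain ⟨g, h, hh, rfl⟩ := H
    refine ⟨g, h, hh, Subtype.ext ?_⟩
    rw [IntermediateField.coe_div, coe_gaussianIntHom, coe_gaussianIntHom]
  have hne : ∀ {h : GaussianInt}, h ≠ 0 → GaussianInt.toComplex h ≠ 0 := fun hh h0 =>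
    hh (GaussianInt.toComplex_eq_zero.1 h0)
  induction hz using IntermediateField.adjoin_induction with
  | mem x hx =>
    rw [Set.mem_singleton_iff] at hx
    exact ⟨⟨0, 1⟩, 1, one_ne_zero, by rw [hx]; simp [GaussianInt.toComplex_def']⟩
  | algebraMap q =>
    refine ⟨(q.num : GaussianInt), (q.den : GaussianInt), by exact_mod_cast q.den_ne_zero, ?_⟩
    rw [map_intCast, map_natCast]
    conv_lhs => rw [← Rat.num_div_den q]
    simp
  | add x y _ _ hx hy =>
    obtain ⟨g, h, hh, rfl⟩ := hx
    obtain ⟨g', h', hh', rfl⟩ := hy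
    refine ⟨g * h' + h * g', h * h', mul_ne_zero hh hh', ?_⟩
    rw [div_add_div _ _ (hne hh) (hne hh')]
    simp
  | inv x _ hx =>
    obtain ⟨g, h, hh, rfl⟩ := hx
    by_cases hg : g = 0
    · exact ⟨0, 1, one_ne_zero, by simp [hg]⟩
    · exact ⟨h, g, hg, inv_div _ _⟩
  | mul x y _ _ hx hy =>
    obtain ⟨g, h, hh, rfl⟩ := hx
    obtain ⟨g', h', hh', rfl⟩ := hy
    refine ⟨g * g', h * h', mul_ne_zero hh hh', ?_⟩
    rw [div_mul_div_comm]
    simp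

/-- The embedding of the Gaussian integers into `K`. -/
noncomputable def gaussianIntHomK : GaussianInt →+* FieldK :=
  (algebraMap GaussianField FieldK).comp gaussianIntHom

theorem exists_gaussianIntHomK_div (a : GaussianField) :
    ∃ g h, h ≠ 0 ∧ algebraMap GaussianField FieldK a = gaussianIntHomK g / gaussianIntHomK h := by
  obtain ⟨g, h, hh, rfl⟩ := exists_gaussianIntHom_div a
  exact ⟨g, h, hh, map_div₀ _ _ _⟩

theorem gaussianIntHomK_injective : Function.Injective gaussianIntHomK := by
  refine (algebraMap GaussianField FieldK).injective.comp fun g h hgh => ?_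
  have := congrArg (fun a : GaussianField => (a : ℂ)) hgh
  simp only [coe_gaussianIntHom] at this
  exact GaussianInt.toComplex_injective this

theorem gaussianIntHomK_i : gaussianIntHomK ⟨0, 1⟩ = algebraMap GaussianField FieldK gaussI := by
  rw [gaussianIntHomK, RingHom.comp_apply, gaussianIntHom_apply]
  simp

/-- There is a place of `K` above the prime `2 + i` of `ℤ[i]`. -/
theorem exists_valuationSubring : ∃ V : ValuationSubring FieldK,
    (∀ g, V.valuation (gaussianIntHomK g) ≤ 1) ∧ V.valuation (gaussianIntHomK ⟨2, 1⟩) < 1 := by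
  let e := RingHom.rangeRestrict gaussianIntHomK
  let I : Ideal gaussianIntHomK.range := Ideal.span {e ⟨2, 1⟩}
  have hI : I ≠ ⊤ := by
    intro h
    rw [Ideal.span_singleton_eq_top] at h
    obtain ⟨⟨b, c, rfl⟩, hc⟩ := h.exists_right_inv
    have h1 : gaussianIntHomK (⟨2, 1⟩ * c) = gaussianIntHomK 1 := by
      rw [map_mul, map_one]
      exact congrArg Subtype.val hc
    have h2 := (Valuation.two_add_i_dvd_iff 1).1 ⟨c, (gaussianIntHomK_injective h1).symm⟩
    simp at h2
  obtain ⟨V, hV, hV'⟩ := Ideal.image_subset_nonunits_valuationSubring I hI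
  refine ⟨V, fun g => (V.valuation_le_one_iff _).2 (hV ⟨g, rfl⟩), ?_⟩
  exact V.mem_nonunits_iff.1 (hV' ⟨e ⟨2, 1⟩, Ideal.mem_span_singleton_self _, rfl⟩)

/-! ### Total ramification of `K` above `2 + i` -/

/-- `θ + 1` satisfies an Eisenstein equation at `5`. -/
theorem theta_add_one_eisenstein : (theta + 1) ^ 4 =
    5 * (1 - (theta + 1) - (theta + 1) ^ 2 + (theta + 1) ^ 3) := by
  linear_combination theta_quartic

theorem theta_add_one_ne_zero : theta + 1 ≠ 0 := by
  intro h
  have := theta_add_one_eisenstein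
  rw [h] at this
  norm_num at this

/-- The minimal polynomial of `θ` over `ℚ(i)`. -/
noncomputable def thetaPoly : GaussianField[X] := X ^ 4 - X ^ 3 - C 4 * X ^ 2 + C 4 * X + 1

theorem thetaPoly_monic : thetaPoly.Monic := by
  unfold thetaPoly; monicity!

theorem thetaPoly_natDegree : thetaPoly.natDegree = 4 := by
  unfold thetaPoly; compute_degree!

theorem aeval_thetaPoly (x : FieldK) :
    aeval x thetaPoly = x ^ 4 - x ^ 3 - 4 * x ^ 2 + 4 * x + 1 := by
  simp [thetaPoly, map_ofNat]

theorem isIntegral_theta : IsIntegral GaussianField theta :=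
  ⟨thetaPoly, thetaPoly_monic, by rw [← aeval_def, aeval_thetaPoly, theta_quartic]⟩

theorem isIntegral_two_cos :
    IsIntegral GaussianField ((2 * Real.cos (2 * Real.pi / 15) : ℝ) : ℂ) :=
  isIntegral_theta.map (IntermediateField.val FieldK)

theorem exists_eq_sum_pow (x : FieldK) :
    ∃ a : Fin 4 → GaussianField,
      x = ∑ j, algebraMap GaussianField FieldK (a j) * (theta + 1) ^ (j : ℕ) := by
  obtain ⟨p, hp⟩ :=
    (IntermediateField.adjoin.powerBasis isIntegral_two_cos).exists_eq_aeval' x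
  have hp : x = aeval theta p := hp
  set q := thetaPoly.comp (X - C 1) with hq
  have hqm : q.Monic := thetaPoly_monic.comp_X_sub_C 1
  have hqd : q.natDegree = 4 := by
    rw [hq, natDegree_comp, thetaPoly_natDegree, natDegree_X_sub_C]
  have hq0 : aeval (theta + 1) q = 0 := by
    rw [hq, aeval_comp, map_sub, aeval_X, aeval_C, map_one, add_sub_cancel_right, aeval_thetaPoly,
      theta_quartic]
  set r := p.comp (X - C 1) %ₘ q with hr
  have hrd : r.natDegree < 4 := by
    rw [← hqd]
    exact natDegree_modByMonic_lt _ hqm (fun h => by rw [h] at hqd; simp at hqd)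
  have hrx : x = aeval (theta + 1) r := by
    rw [hr, aeval_modByMonic_eq_self_of_root hq0, aeval_comp, map_sub, aeval_X, aeval_C, map_one,
      add_sub_cancel_right, hp]
  refine ⟨fun j => r.coeff j, ?_⟩
  rw [hrx, aeval_eq_sum_range' hrd, Finset.sum_range]
  simp only [Algebra.smul_def]

section Place

variable {Γ₀ : Type*} [LinearOrderedCommGroupWithZero Γ₀] {v : Valuation FieldK Γ₀}

theorem map_theta_add_one_lt_one (hle : ∀ g, v (gaussianIntHomK g) ≤ 1)
    (hlt : v (gaussianIntHomK ⟨2, 1⟩) < 1) : v (theta + 1) < 1 :=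
  (Valuation.map_eisenstein_root hle hlt theta_add_one_eisenstein).1

/-- `2 + i` is totally ramified in `K`, with uniformizer `θ + 1`. -/
theorem exists_map_algebraMap_eq_zpow (hle : ∀ g, v (gaussianIntHomK g) ≤ 1)
    (hlt : v (gaussianIntHomK ⟨2, 1⟩) < 1) (a : GaussianField) (ha : a ≠ 0) :
    ∃ k : ℤ, v (algebraMap GaussianField FieldK a) = v (theta + 1) ^ (((4 : ℕ) : ℤ) * k) := by
  obtain ⟨g, h, hh, hgh⟩ := exists_gaussianIntHomK_div a
  have hg : g ≠ 0 := by
    rintro rfl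
    rw [map_zero, zero_div, map_eq_zero] at hgh
    exact ha hgh
  obtain ⟨k, hk⟩ := Valuation.exists_map_div_eq_zpow hle hlt hg hh
  refine ⟨k, ?_⟩
  rw [hgh, hk, zpow_mul, zpow_natCast,
    (Valuation.map_eisenstein_root hle hlt theta_add_one_eisenstein).2]

/-- The residue field of `K` above `2 + i` is the prime field. -/
theorem exists_intCast_map_sub_lt_one (hle : ∀ g, v (gaussianIntHomK g) ≤ 1)
    (hlt : v (gaussianIntHomK ⟨2, 1⟩) < 1) {x : FieldK} (hx : v x ≤ 1) :
    ∃ m : ℤ, v (x - m) < 1 := by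
  obtain ⟨a, rfl⟩ := exists_eq_sum_pow x
  have h := Valuation.map_sub_lt_one_of_sum_le_one theta_add_one_ne_zero
    (map_theta_add_one_lt_one hle hlt) (exists_map_algebraMap_eq_zpow hle hlt) a hx
  set x := ∑ j, algebraMap GaussianField FieldK (a j) * (theta + 1) ^ (j : ℕ)
  obtain ⟨g, c, hc, hgc⟩ := exists_gaussianIntHomK_div (a 0)
  have h0 : v (algebraMap GaussianField FieldK (a 0)) ≤ 1 := by
    have : algebraMap GaussianField FieldK (a 0) =
      x - (x - algebraMap GaussianField FieldK (a 0)) := by ring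
    rw [this]
    exact v.map_sub_le hx h.le
  rw [hgc] at h h0
  obtain ⟨m, hm⟩ := Valuation.exists_intCast_map_div_sub_lt_one hle hlt h0
  refine ⟨m, ?_⟩
  rw [← sub_add_sub_cancel]
  exact v.map_add_lt h hm

/-- The place above `2 + i` is unique, hence invariant under automorphisms. -/
theorem map_algEquiv (hle : ∀ g, v (gaussianIntHomK g) ≤ 1)
    (hlt : v (gaussianIntHomK ⟨2, 1⟩) < 1) (σ : FieldK ≃ₐ[GaussianField] FieldK) (x : FieldK) :
    v (σ x) = v x := by
  let w : Valuation FieldK Γ₀ := v.comap (σ : FieldK →+* FieldK)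
  have hwF : ∀ a, w (algebraMap GaussianField FieldK a) = v (algebraMap GaussianField FieldK a) :=
    fun a => congrArg v (σ.commutes a)
  have hwg : ∀ g, w (gaussianIntHomK g) = v (gaussianIntHomK g) := fun g => hwF _
  have hw := Valuation.map_eisenstein_root (v := w) (fun g => by rw [hwg]; exact hle g)
    (by rw [hwg]; exact hlt) theta_add_one_eisenstein
  have hv := Valuation.map_eisenstein_root hle hlt theta_add_one_eisenstein
  have hwy : w (theta + 1) = v (theta + 1) := by
    rw [hwg, ← hv.2] at hw
    exact (pow_left_inj₀ zero_le zero_le (by norm_num)).1 hw.2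
  obtain ⟨a, rfl⟩ := exists_eq_sum_pow x
  exact Valuation.map_sum_eq_map_sum theta_add_one_ne_zero hv.1
    (exists_map_algebraMap_eq_zpow hle hlt) hwy hwF a

/-- Automorphisms act trivially on the residue field: the extension is totally ramified. -/
theorem map_algEquiv_sub_lt_one (hle : ∀ g, v (gaussianIntHomK g) ≤ 1)
    (hlt : v (gaussianIntHomK ⟨2, 1⟩) < 1) (σ : FieldK ≃ₐ[GaussianField] FieldK) {x : FieldK}
    {m : ℤ} (hm : v (x - m) < 1) : v (σ x - m) < 1 := by
  have : σ x - m = σ (x - m) := by rw [map_sub, map_intCast]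
  rwa [this, map_algEquiv hle hlt]

end Place

theorem eq_zero_of_sum_theta_add_one_pow (a : Fin 4 → GaussianField)
    (h : ∑ j, algebraMap GaussianField FieldK (a j) * (theta + 1) ^ (j : ℕ) = 0) (j : Fin 4) :
    a j = 0 := by
  obtain ⟨V, hle, hlt⟩ := exists_valuationSubring
  exact Valuation.eq_zero_of_sum_eq_zero theta_add_one_ne_zero (map_theta_add_one_lt_one hle hlt)
    (exists_map_algebraMap_eq_zpow hle hlt) a h j

/-! ### The degree and the generating automorphism -/

theorem finrank_fieldK : Module.finrank GaussianField FieldK = 4 := by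
  have hli : LinearIndependent GaussianField (fun j : Fin 4 => (theta + 1) ^ (j : ℕ)) := by
    rw [Fintype.linearIndependent_iff]
    intro a ha
    simp only [Algebra.smul_def] at ha
    exact eq_zero_of_sum_theta_add_one_pow a ha
  have hsp : ⊤ ≤ Submodule.span GaussianField
      (Set.range fun j : Fin 4 => (theta + 1) ^ (j : ℕ)) := by
    intro x _
    obtain ⟨a, rfl⟩ := exists_eq_sum_pow x
    refine Submodule.sum_mem _ fun j _ => ?_
    rw [← Algebra.smul_def]
    exact Submodule.smul_mem _ _ (Submodule.subset_span ⟨j, rfl⟩)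
  simpa using Module.finrank_eq_card_basis (Module.Basis.mk hli hsp)

theorem finiteDimensional_fieldK : FiniteDimensional GaussianField FieldK :=
  IntermediateField.adjoin.finiteDimensional isIntegral_two_cos

theorem minpoly_theta : minpoly GaussianField theta = thetaPoly := by
  refine Polynomial.eq_of_dvd_of_natDegree_le_of_leadingCoeff
    (minpoly.dvd _ _ (by rw [aeval_thetaPoly, theta_quartic])) ?_ ?_
  · rw [thetaPoly_natDegree, ← finrank_fieldK,
      IntermediateField.adjoin.finrank isIntegral_two_cos]
    exact (congrArg natDegree (minpoly.algebraMap_eq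
      (algebraMap FieldK ℂ).injective theta)).le
  · rw [thetaPoly_monic, minpoly.monic isIntegral_theta]

theorem algHom_ext_theta {f g : FieldK →ₐ[GaussianField] FieldK} (h : f theta = g theta) :
    f = g :=
  (IntermediateField.adjoin.powerBasis isIntegral_two_cos).algHom_ext h

/-- The minimal polynomial `f` of `θ` satisfies `f(x² - 2) = f(x) f(-x)`, so `θ² - 2` is a
conjugate of `θ`. -/
theorem exists_algEquiv_theta :
    ∃ σ : FieldK ≃ₐ[GaussianField] FieldK, σ theta = theta ^ 2 - 2 := by
  have := finiteDimensional_fieldK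
  have hroot : aeval (theta ^ 2 - 2) (minpoly GaussianField
      (IntermediateField.adjoin.powerBasis isIntegral_two_cos).gen) = 0 := by
    change aeval (theta ^ 2 - 2) (minpoly GaussianField theta) = 0
    rw [minpoly_theta, aeval_thetaPoly]
    linear_combination (theta ^ 4 + theta ^ 3 - 4 * theta ^ 2 - 4 * theta + 1) * theta_quartic
  let f := (IntermediateField.adjoin.powerBasis isIntegral_two_cos).lift _ hroot
  exact ⟨AlgEquiv.ofBijective f (Algebra.IsAlgebraic.algHom_bijective f),
    (IntermediateField.adjoin.powerBasis isIntegral_two_cos).lift_gen _ hroot⟩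

section Automorphism

variable {σ : FieldK ≃ₐ[GaussianField] FieldK}

theorem sq_apply_theta (hσ : σ theta = theta ^ 2 - 2) :
    (σ ^ 2) theta = theta ^ 3 - 4 * theta + 1 := by
  rw [pow_two, AlgEquiv.mul_apply, hσ, map_sub, map_pow, hσ, map_ofNat]
  linear_combination theta_quartic

theorem orderOf_eq_four (hσ : σ theta = theta ^ 2 - 2) : orderOf σ = 4 := by
  have h2 := sq_apply_theta hσ
  refine orderOf_eq_prime_pow (p := 2) (n := 1) ?_ ?_
  · intro h
    rw [pow_one] at h
    rw [h, AlgEquiv.one_apply] at h2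
    -- `θ³ - 5 θ + 1 = 0`, in powers of `θ + 1`
    have h3 := eq_zero_of_sum_theta_add_one_pow ![5, -2, -3, 1] (by
      simp [Fin.sum_univ_four, map_ofNat]
      linear_combination -h2) 3
    simp at h3
  · have h3 : (σ ^ 3) theta = -theta ^ 3 - theta ^ 2 + 3 * theta + 2 := by
      rw [pow_succ', AlgEquiv.mul_apply, h2]
      simp only [map_add, map_sub, map_mul, map_pow, map_ofNat, map_one, hσ]
      linear_combination (theta ^ 2 + theta - 1) * theta_quartic
    have h4 : (σ ^ 4) theta = theta := by
      rw [pow_succ', AlgEquiv.mul_apply, h3]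
      simp only [map_add, map_sub, map_mul, map_pow, map_ofNat, map_neg, hσ]
      linear_combination (-theta ^ 2 - theta) * theta_quartic
    have h : ((σ ^ 4 : FieldK ≃ₐ[GaussianField] FieldK) : FieldK →ₐ[GaussianField] FieldK) =
        AlgHom.id _ _ := algHom_ext_theta h4
    ext x
    exact congrArg (fun f => ((f x : FieldK) : ℂ)) h

theorem card_algEquiv_fieldK : Nat.card (FieldK ≃ₐ[GaussianField] FieldK) = 4 := by
  have := finiteDimensional_fieldK
  obtain ⟨σ, hσ⟩ := exists_algEquiv_theta
  refine le_antisymm ?_ ?_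
  · rw [Nat.card_eq_fintype_card, ← finrank_fieldK]
    exact AlgEquiv.card_le
  · rw [← orderOf_eq_four hσ]
    exact orderOf_le_card

theorem zpowers_eq_top (hσ : σ theta = theta ^ 2 - 2) : Subgroup.zpowers σ = ⊤ := by
  have := finiteDimensional_fieldK
  refine Subgroup.eq_top_of_card_eq _ ?_
  rw [Nat.card_zpowers, orderOf_eq_four hσ, card_algEquiv_fieldK]

end Automorphism

theorem isGalois_fieldK : IsGalois GaussianField FieldK := by
  have := finiteDimensional_fieldK
  exact IsGalois.of_card_aut_eq_finrank GaussianField FieldK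
    (by rw [card_algEquiv_fieldK, finrank_fieldK])

/-! ### Norms -/

/-- The norm of a unit at a totally ramified place of degree `4` is a fourth power in the residue
field, since all four conjugates have the same residue. -/
theorem exists_dvd_sub_pow_four_of_norm_eq {x : FieldK} {g : GaussianInt}
    (hx : Algebra.norm GaussianField x = gaussianIntHom g) (hg : ¬ (5 : ℤ) ∣ g.re - 2 * g.im) :
    ∃ m : ℤ, (5 : ℤ) ∣ g.re - 2 * g.im - m ^ 4 := by
  have := finiteDimensional_fieldK
  have := isGalois_fieldK
  obtain ⟨V, hle, hlt⟩ := exists_valuationSubring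
  have hprod : gaussianIntHomK g = ∏ τ : FieldK ≃ₐ[GaussianField] FieldK, τ x := by
    rw [← Algebra.norm_eq_prod_automorphisms, hx]; rfl
  have hcard : Fintype.card (FieldK ≃ₐ[GaussianField] FieldK) = 4 := by
    rw [← Nat.card_eq_fintype_card, card_algEquiv_fieldK]
  have hvx : V.valuation x = 1 := by
    have h := Valuation.map_eq_one_of_not_dvd hle hlt
      (fun h => hg ((Valuation.two_add_i_dvd_iff g).1 h))
    rw [hprod, map_prod] at h
    simp only [map_algEquiv hle hlt] at h
    rw [Finset.prod_const, Finset.card_univ, hcard] at h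
    exact (pow_eq_one_iff_of_nonneg zero_le (by norm_num)).1 h
  obtain ⟨m, hm⟩ := exists_intCast_map_sub_lt_one hle hlt hvx.le
  refine ⟨m, ?_⟩
  let a : (FieldK ≃ₐ[GaussianField] FieldK) → V := fun τ =>
    ⟨τ x, (V.valuation_le_one_iff _).1 (by rw [map_algEquiv hle hlt, hvx])⟩
  have ha : ∀ τ, IsLocalRing.residue V (a τ) = (m : IsLocalRing.ResidueField V) := by
    intro τ
    rw [← map_intCast (IsLocalRing.residue V), ← sub_eq_zero, ← map_sub,
      IsLocalRing.residue_eq_zero_iff, V.valuation_lt_one_iff]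
    simpa [a] using map_algEquiv_sub_lt_one hle hlt τ hm
  have hres : IsLocalRing.residue V (∏ τ, a τ - m ^ 4) = 0 := by
    rw [map_sub, map_prod, Finset.prod_congr rfl fun τ _ => ha τ, Finset.prod_const,
      Finset.card_univ, hcard, map_pow, map_intCast, sub_self]
  rw [IsLocalRing.residue_eq_zero_iff, V.valuation_lt_one_iff] at hres
  have hval : V.valuation (gaussianIntHomK (g - (m ^ 4 : ℤ))) < 1 := by
    rw [map_sub, hprod, map_intCast]
    simpa [a] using hres
  have hdvd : (⟨2, 1⟩ : GaussianInt) ∣ g - (m ^ 4 : ℤ) := by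
    by_contra h
    exact hval.ne (Valuation.map_eq_one_of_not_dvd hle hlt h)
  have := (Valuation.two_add_i_dvd_iff _).1 hdvd
  simp only [Zsqrtd.re_sub, Zsqrtd.im_sub, Zsqrtd.re_intCast, Zsqrtd.im_intCast] at this
  convert this using 1
  ring

theorem norm_ne_gaussianIntHom {g : GaussianInt} (h0 : (g.re - 2 * g.im) % 5 ≠ 0)
    (h1 : (g.re - 2 * g.im) % 5 ≠ 1) (x : FieldK) :
    Algebra.norm GaussianField x ≠ gaussianIntHom g := by
  intro hx
  obtain ⟨m, hm⟩ := exists_dvd_sub_pow_four_of_norm_eq hx (by omega)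
  have hm4 : m ^ 4 % 5 = 0 ∨ m ^ 4 % 5 = 1 := by
    have h5 : m % 5 = 0 ∨ m % 5 = 1 ∨ m % 5 = 2 ∨ m % 5 = 3 ∨ m % 5 = 4 := by omega
    rcases h5 with h | h | h | h | h <;> simp [pow_succ, Int.mul_emod, h]
  omega

/-! ### The division algebra -/

/-- `3` has order `4` in `𝔽₅ˣ`, so its fourth roots generate `𝔽₆₂₅`. -/
theorem irreducible_X_pow_four_sub_three : Irreducible (X ^ 4 - C 3 : (ZMod 5)[X]) := by
  have hlin : ∀ x : ZMod 5, 0 ≠ x ^ 4 - 3 := by decide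
  have hquad : ∀ a b c d : ZMod 5, ¬ ∀ x : ZMod 5,
      (x ^ 2 + (a + b * x)) * (x ^ 2 + (c + d * x)) = x ^ 4 - 3 := by decide
  have : Fact (Nat.Prime 5) := ⟨Nat.prime_five⟩
  have hm : (X ^ 4 - C 3 : (ZMod 5)[X]).Monic := monic_X_pow_sub_C _ (by norm_num)
  have hd : (X ^ 4 - C 3 : (ZMod 5)[X]).natDegree = 4 := natDegree_X_pow_sub_C
  rw [hm.irreducible_iff_lt_natDegree_lt (fun h => by rw [h] at hd; simp at hd)]
  rintro q hq hqd ⟨r, hr⟩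
  have hrm : r.Monic := hq.of_mul_monic_left (hr ▸ hm)
  have hsum : q.natDegree + r.natDegree = 4 := by rw [← hq.natDegree_mul hrm, ← hr, hd]
  have heval : ∀ x : ZMod 5, q.eval x * r.eval x = x ^ 4 - 3 := fun x => by
    rw [← eval_mul, ← hr]; simp
  rw [hd, Finset.mem_Ioc] at hqd
  have h12 : q.natDegree = 1 ∨ q.natDegree = 2 := by omega
  rcases h12 with h1 | h2
  · have hroot : q.eval (-q.coeff 0) = 0 := by
      conv_lhs => rw [hq.as_sum, h1]
      simp
    have h := heval (-q.coeff 0)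
    rw [hroot, zero_mul] at h
    exact hlin _ h
  · have hr2 : r.natDegree = 2 := by omega
    -- two monic quadratics are determined by their values on `𝔽₅`
    have hval : ∀ x : ZMod 5, (x ^ 2 + (q.coeff 0 + q.coeff 1 * x)) *
        (x ^ 2 + (r.coeff 0 + r.coeff 1 * x)) = x ^ 4 - 3 := fun x => by
      rw [← heval x]
      conv_rhs => rw [hq.as_sum, hrm.as_sum, h2, hr2]
      simp [Finset.sum_range_succ]
    exact hquad _ _ _ _ hval

/-- The residue field above `2 + i` is `𝔽₅`, where `i` becomes `3`. -/
theorem irreducible_X_pow_four_sub_residue {V : ValuationSubring FieldK}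
    (hle : ∀ g, V.valuation (gaussianIntHomK g) ≤ 1)
    (hlt : V.valuation (gaussianIntHomK ⟨2, 1⟩) < 1) {c : V}
    (hc : (c : FieldK) = algebraMap GaussianField FieldK gaussI) :
    Irreducible (X ^ 4 - C (IsLocalRing.residue V c)) := by
  have : Fact (Nat.Prime 5) := ⟨Nat.prime_five⟩
  have hzero : ∀ a : V, V.valuation (a : FieldK) < 1 → IsLocalRing.residue V a = 0 := fun a ha =>
    (IsLocalRing.residue_eq_zero_iff _).2 ((V.valuation_lt_one_iff _).2 ha)
  have : CharP (IsLocalRing.ResidueField V) 5 := by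
    rw [CharP.charP_iff_prime_eq_zero Nat.prime_five, ← map_natCast (IsLocalRing.residue V)]
    refine hzero _ ?_
    rw [SubringClass.coe_natCast, Nat.cast_ofNat]
    exact Valuation.map_five_lt_one hle hlt
  let f := ZMod.castHom (dvd_refl 5) (IsLocalRing.ResidueField V)
  have hf : Function.Bijective f := by
    refine ⟨f.injective, fun a => ?_⟩
    obtain ⟨a, rfl⟩ := IsLocalRing.residue_surjective a
    obtain ⟨m, hm⟩ := exists_intCast_map_sub_lt_one hle hlt (V.valuation_le_one a)
    refine ⟨m, ?_⟩
    rw [map_intCast, ← map_intCast (IsLocalRing.residue V), eq_comm, ← sub_eq_zero, ← map_sub]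
    exact hzero _ (by simpa using hm)
  have h3 : IsLocalRing.residue V c = f 3 := by
    have h3' : f 3 = IsLocalRing.residue V 3 := by rw [map_ofNat, map_ofNat]
    rw [h3', ← sub_eq_zero, ← map_sub]
    refine hzero _ ?_
    have hi : ((c - 3 : V) : FieldK) = gaussianIntHomK (⟨2, 1⟩ * ⟨-1, 1⟩) := by
      have : (⟨2, 1⟩ * ⟨-1, 1⟩ : GaussianInt) = ⟨0, 1⟩ - 3 := by ext <;> rfl
      rw [this, map_sub, gaussianIntHomK_i, map_ofNat, ← hc]
      rfl
    rw [hi, map_mul, map_mul]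
    exact mul_lt_one_of_lt_of_le hlt (hle _)
  have hmap : X ^ 4 - C (IsLocalRing.residue V c) =
      Polynomial.mapEquiv (RingEquiv.ofBijective f hf) (X ^ 4 - C 3) := by
    rw [mapEquiv_apply, h3]
    simp
  rw [hmap, MulEquiv.irreducible_iff]
  exact irreducible_X_pow_four_sub_three

theorem isDivisionAlgebra_cyclicAlgebra {σ : FieldK ≃ₐ[GaussianField] FieldK}
    (hσ : σ theta = theta ^ 2 - 2) : IsDivisionAlgebra (CyclicAlgebra σ gaussI) := by
  have := finiteDimensional_fieldK
  obtain ⟨V, hle, hlt⟩ := exists_valuationSubring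
  have hord := orderOf_eq_four hσ
  let c : V := ⟨algebraMap GaussianField FieldK gaussI,
    (V.valuation_le_one_iff _).1 (by rw [← gaussianIntHomK_i]; exact hle _)⟩
  refine CyclicAlgebra.isDivisionAlgebra_of_noZeroDivisors (by rw [hord]; norm_num) ?_
  refine CyclicAlgebra.noZeroDivisors_of_irreducible (V := V) (map_algEquiv hle hlt σ) ?_ c rfl ?_
  · intro x hx
    obtain ⟨m, hm⟩ := exists_intCast_map_sub_lt_one hle hlt ((V.valuation_le_one_iff x).2 hx)
    rw [← sub_sub_sub_cancel_right _ _ (m : FieldK)]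
    exact V.valuation.map_sub_lt (map_algEquiv_sub_lt_one hle hlt σ hm) hm
  · rw [hord]
    exact irreducible_X_pow_four_sub_residue hle hlt rfl

end

theorem mainTheorem2 :
    IsGalois GaussianField FieldK ∧
    Module.finrank GaussianField FieldK = 4 ∧
    (∀ x : FieldK, Algebra.norm GaussianField x ≠ gaussI ∧
      Algebra.norm GaussianField x ≠ -gaussI ∧ Algebra.norm GaussianField x ≠ -1) ∧
    (∃! σ : FieldK ≃ₐ[GaussianField] FieldK,
      ((σ theta : FieldK) : ℂ) = ((2 * Real.cos (4 * Real.pi / 15) : ℝ) : ℂ)) ∧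
    ∀ σ : FieldK ≃ₐ[GaussianField] FieldK,
      ((σ theta : FieldK) : ℂ) = ((2 * Real.cos (4 * Real.pi / 15) : ℝ) : ℂ) →
      Subgroup.zpowers σ = ⊤ ∧ IsDivisionAlgebra (CyclicAlgebra σ gaussI) := by
  simp only [coe_eq_two_cos_iff]
  refine ⟨isGalois_fieldK, finrank_fieldK, fun x => ⟨?_, ?_, ?_⟩, ?_, fun σ hσ =>
    ⟨zpowers_eq_top hσ, isDivisionAlgebra_cyclicAlgebra hσ⟩⟩
  -- modulo `2 + i`, the numbers `i`, `-i`, `-1` are `3`, `2`, `4`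
  · have h := norm_ne_gaussianIntHom (g := ⟨0, 1⟩) (by norm_num) (by norm_num) x
    simpa [gaussianIntHom_apply] using h
  · have h := norm_ne_gaussianIntHom (g := ⟨0, -1⟩) (by norm_num) (by norm_num) x
    simpa [gaussianIntHom_apply] using h
  · have h := norm_ne_gaussianIntHom (g := ⟨-1, 0⟩) (by norm_num) (by norm_num) x
    simpa [gaussianIntHom_apply] using h
  · obtain ⟨σ, hσ⟩ := exists_algEquiv_theta
    refine ⟨σ, hσ, fun τ hτ => ?_⟩
    have h : (τ : FieldK →ₐ[GaussianField] FieldK) = σ := algHom_ext_theta (hτ.trans hσ.symm)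
    exact AlgEquiv.ext fun x => DFunLike.congr_fun h x
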